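/- Let $N\ge 1$, let $\mathbb{R}_+^N$ be the cone of vectors with nonnegative entries, ordered entrywise, and let $f:\mathbb{R}_+^N\to\mathbb{R}_+^N$ be monotone ($x\le y$ implies $f(x)\le f(y)$) and positively homogeneous of degree one ($f(cx)=c f(x)$ for all $c>0$). Suppose that $f$ has an eigenvector $u$ with positive entries, $f(u)=\lambda u$ with $\lambda>0$, normalized so that $\prod_{i=1}^N u_i=1$, and that $f$ is differentiable at $u$. List the complex eigenvalues of the matrix $f'(u)$, counted with algebraic multiplicity, as $\mu_1=\lambda,\mu_2,\dots,\mu_N$ (the number $\lambda$ is an eigenvalue of $f'(u)$, since $f'(u)u=\lambda u$), set $$\vartheta=\max_{2\le i\le N}\frac{|1+\mu_i\lambda^{-1}|}{2}$$ (with $\vartheta=0$ if $N=1$), and suppose that $\vartheta<1$. For every vector $v^0$ with positive entries and $\prod_{i=1}^N v^0_i=1$, define the projective Krasnoselskii–Mann iteration by $$v^{k+1}_i=\left(\frac{f(v^k)_i}{G(f(v^k))}\,v^k_i\right)^{1/2}\quad(1\le i\le N,\ k\ge 0),\qquad G(x)=(x_1\cdots x_N)^{1/N}.$$ Then $$\limsup_{k\to\infty}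 d_T(v^k,u)^{1/k}\le\vartheta ,$$ where $d_T(x,y)=\max_{1\le i\le N}|\log x_i-\log y_i|$ is Thompson's metric. -/

import Mathlib

open Filter
open scoped NNReal

noncomputable section

namespace ProjKM

/-- Thompson's metric on positive vectors: the sup-norm distance between entrywise logarithms.
The norm on `Fin N → ℝ` is the sup-norm. -/
def thompsonDist {N : ℕ} (x y : Fin N → ℝ) : ℝ :=
  ‖fun i => Real.log (x i) - Real.log (y i)‖

/-- The geometric mean of the components of a vector. -/
def geomMean {N : ℕ} (x : Fin N → ℝ) : ℝ :=
  (∏ i, x i) ^ ((1 : ℝ) / (N : ℝ))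

/-- One step of the projective Krasnoselskii-Mann iteration:
the entrywise square root of the entrywise product of `f x / G (f x)` and `x`. -/
def kmStep {N : ℕ} (f : (Fin N → ℝ) → (Fin N → ℝ)) (x : Fin N → ℝ) : Fin N → ℝ :=
  fun i => Real.sqrt (f x i / geomMean (f x) * x i)

/-- The projective Krasnoselskii-Mann iteration started at `v₀`. -/
def kmSeq {N : ℕ} (f : (Fin N → ℝ) → (Fin N → ℝ)) (v₀ : Fin N → ℝ) : ℕ → (Fin N → ℝ)
  | 0 => v₀
  | k + 1 => kmStep f (kmSeq f v₀ k)

/-- The matrix of the derivative of `f` at `u`, in the canonical basis. -/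
def jacobian {N : ℕ} (f : (Fin N → ℝ) → (Fin N → ℝ)) (u : Fin N → ℝ) :
    Matrix (Fin N) (Fin N) ℝ :=
  LinearMap.toMatrix' (fderiv ℝ f u : (Fin N → ℝ) →ₗ[ℝ] (Fin N → ℝ))

/-- The complex eigenvalues of a real matrix, counted with algebraic multiplicity. -/
def eigenvalues {N : ℕ} (A : Matrix (Fin N) (Fin N) ℝ) : Multiset ℂ :=
  (A.map (fun a : ℝ => (a : ℂ))).charpoly.roots

/-- The maximum of `|1 + μ / lam| / 2` over the eigenvalues `μ` of `A` that remain in the list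
(with multiplicities) after one occurrence of `lam` has been removed. The supremum is that of a
finite multiset of nonnegative reals, so it is a maximum, and it is `0` if nothing remains. -/
def rate {N : ℕ} (A : Matrix (Fin N) (Fin N) ℝ) (lam : ℝ) : ℝ≥0 :=
  (((eigenvalues A).erase (lam : ℂ)).map
    (fun μ : ℂ => ‖1 + μ * (lam : ℂ)⁻¹‖₊ / 2)).sup

end ProjKM

end

namespace ProjKM

open scoped Topology

/-! In the coordinates `x = log v - log u` the iteration is `kmLog`: average `x` with `logConj x`,
then subtract the mean. Since `logConj` preserves order and commutes with adding constants, `kmLog`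
is nonexpansive for `max x - min x` (`oscSeminorm_kmLog_sub_le`), which dominates the sup-norm on
zero-sum vectors. The derivative at the fixed point `0` is `kmLin`. Centering removes the constant
direction, which accounts for one copy of `lam`; each nonzero eigenvalue left is some `(1 + μ / lam)
/ 2` (`nnnorm_le_rate`). By Gelfand's formula, an iterate contracts near `0` by `r ^ n`, for any `r`
above the rate. Nonexpansiveness makes this local attraction global
(`exists_eventually_norm_iterate_le`). -/

/-! ### Geometric rates and orbits of nonexpansive maps -/

/-- An eventual geometric bound on a nonnegative sequence bounds the growth rate of its roots. -/
theorem limsup_rpow_one_div_le {d : ℕ → ℝ} (hd : ∀ k, 0 ≤ d k) {θ : ℝ} (hθ0 : 0 ≤ θ) (hθ : θ < 1)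
    (h : ∀ r, θ < r → r < 1 → ∃ K : ℝ, ∀ᶠ k in atTop, d k ≤ K * r ^ k) :
    limsup (fun k : ℕ => ((d k ^ ((1 : ℝ) / (k : ℝ)) : ℝ) : EReal)) atTop ≤ (θ : EReal) := by
  have key : ∀ r, θ < r → r < 1 →
      limsup (fun k : ℕ => ((d k ^ ((1 : ℝ) / (k : ℝ)) : ℝ) : EReal)) atTop ≤ (r : EReal) := by
    intro r hr hr1
    have hr0 : 0 < r := hθ0.trans_lt hr
    obtain ⟨K, hK⟩ := h r hr hr1
    -- `K` may fail to be positive, and `K' ^ (1 / k) → 1` needs a positive base.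
    set K' := max K 1
    have hK'0 : 0 < K' := lt_max_of_lt_right one_pos
    have hlim : Tendsto (fun k : ℕ => K' ^ ((1 : ℝ) / (k : ℝ)) * r) atTop (𝓝 r) := by
      have h1 : Tendsto (fun k : ℕ => K' ^ ((1 : ℝ) / (k : ℝ))) atTop (𝓝 (K' ^ (0 : ℝ))) :=
        (Real.continuousAt_const_rpow hK'0.ne').tendsto.comp tendsto_one_div_atTop_nhds_zero_nat
      simpa using h1.mul_const r
    have hlim' : Tendsto (fun k : ℕ => ((K' ^ ((1 : ℝ) / (k : ℝ)) * r : ℝ) : EReal)) atTop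
        (𝓝 (r : EReal)) := (continuous_coe_real_ereal.tendsto r).comp hlim
    rw [← hlim'.limsup_eq]
    refine limsup_le_limsup ?_
    filter_upwards [hK, eventually_gt_atTop 0] with k hk hk0
    rw [EReal.coe_le_coe_iff]
    have hb : d k ≤ K' * r ^ k :=
      hk.trans (mul_le_mul_of_nonneg_right (le_max_left _ _) (by positivity))
    calc d k ^ ((1 : ℝ) / (k : ℝ)) ≤ (K' * r ^ k) ^ ((1 : ℝ) / (k : ℝ)) :=
          Real.rpow_le_rpow (hd k) hb (by positivity)
      _ = K' ^ ((1 : ℝ) / (k : ℝ)) * r := by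
          rw [Real.mul_rpow hK'0.le (by positivity), one_div,
            Real.pow_rpow_inv_natCast hr0.le hk0.ne']
  refine le_of_forall_gt_imp_ge_of_dense fun a ha => ?_
  obtain ⟨r, hr, hra⟩ := EReal.lt_iff_exists_real_btwn.1
    (lt_min ha (EReal.coe_lt_coe_iff.2 hθ : (θ : EReal) < ((1 : ℝ) : EReal)))
  rw [lt_min_iff] at hra
  exact (key r (EReal.coe_lt_coe_iff.1 hr) (EReal.coe_lt_coe_iff.1 hra.2)).trans hra.1.le

/-- Orbits of a map which is nonexpansive for a seminorm `q`, and whose derivative at a fixed point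
has powers of small norm, converge geometrically to this fixed point, whatever their origin. -/
theorem exists_eventually_norm_iterate_le {E : Type*} [NormedAddCommGroup E] [NormedSpace ℝ E]
    (q : Seminorm ℝ E) (W : Submodule ℝ E) {S : E → E} {B : E →L[ℝ] E} {C : ℝ} (hC : 0 < C)
    (hSW : ∀ x, S x ∈ W) (hW : ∀ x ∈ W, ‖x‖ ≤ q x) (hqC : ∀ x, q x ≤ C * ‖x‖)
    (hS : ∀ x y, q (S x - S y) ≤ q (x - y)) (hS0 : S 0 = 0) (hB : HasFDerivAt S B 0)
    {r : ℝ} (hr0 : 0 < r) (hr1 : r < 1) {n : ℕ} (hn : n ≠ 0) (hBn : C * ‖B ^ n‖ < r ^ n)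
    {x : E} (hx : x ∈ W) :
    ∃ K : ℝ, ∀ᶠ k in atTop, ‖S^[k] x‖ ≤ K * r ^ k := by
  have hiter : ∀ k x, x ∈ W → S^[k] x ∈ W := by
    intro k x hx
    cases k with
    | zero => exact hx
    | succ k => rw [Function.iterate_succ_apply']; exact hSW _
  have hnon : ∀ k x y, q (S^[k] x - S^[k] y) ≤ q (x - y) := by
    intro k
    induction k with
    | zero => intro x y; exact le_rfl
    | succ k ih =>
      intro x y
      rw [Function.iterate_succ_apply, Function.iterate_succ_apply]
      exact (ih _ _).trans (hS x y)
  have hfix : ∀ k, S^[k] 0 = 0 := fun k => Function.iterate_fixed hS0 k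
  have hnon0 : ∀ k x, q (S^[k] x) ≤ q x := by
    intro k x
    simpa [hfix] using hnon k x 0
  set c := r ^ n with hc
  have hc1 : c < 1 := pow_lt_one₀ hr0.le hr1 hn
  have hc0 : 0 < c := by positivity
  set G := S^[n] with hG
  have hGd : HasFDerivAt G (B ^ n) 0 := hB.iterate hS0 n
  -- This slack is the little-o constant: it gives `‖G y‖ ≤ (c / C) * ‖y‖`, and returning from the
  -- norm to `q` costs the factor `C`.
  have hlt : 0 < c / C - ‖B ^ n‖ := by
    rw [sub_pos, lt_div_iff₀ hC, mul_comm]; exact hBn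
  obtain ⟨δ, hδ, hloc⟩ : ∃ δ > 0, ∀ y ∈ W, q y ≤ δ → q (G y) ≤ c * q y := by
    have h1 := hGd.isLittleO.def hlt
    obtain ⟨ε, hε, h2⟩ := Metric.eventually_nhds_iff.1 h1
    refine ⟨ε / 2, by positivity, fun y hy hqy => ?_⟩
    have hyn : ‖y‖ ≤ q y := hW y hy
    have h3 := h2 (y := y) (by rw [dist_zero_right]; linarith)
    have hG0 : G 0 = 0 := hfix n
    rw [hG0, sub_zero, sub_zero] at h3
    have h4 : ‖G y‖ ≤ c / C * ‖y‖ := by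
      have h5 := norm_le_norm_sub_add (G y) ((B ^ n) y)
      have h6 := (B ^ n).le_opNorm y
      nlinarith
    calc q (G y) ≤ C * ‖G y‖ := hqC _
      _ ≤ C * (c / C * ‖y‖) := by gcongr
      _ = c * ‖y‖ := by field_simp
      _ ≤ c * q y := by gcongr
  -- Compare `y` with the point `t • y` of the segment to `0` where `q` equals `δ`: the part beyond
  -- it does not expand, and the part inside shrinks by `c`. Each far step thus gains a fixed
  -- amount.
  have hfar : ∀ y ∈ W, δ < q y → q (G y) ≤ q y - (1 - c) * δ := by
    intro y hy hqy
    have hq0 : 0 < q y := hδ.trans hqy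
    set t := δ / q y
    have ht0 : 0 < t := by positivity
    have ht1 : t < 1 := (div_lt_one hq0).2 hqy
    have hqt : q (t • y) = δ := by
      rw [map_smul_eq_mul, Real.norm_of_nonneg ht0.le]
      exact div_mul_cancel₀ _ hq0.ne'
    have h1 := hloc (t • y) (W.smul_mem t hy) hqt.le
    have h2 := hnon n y (t • y)
    have h3 : q (y - t • y) = q y - δ := by
      have : y - t • y = (1 - t) • y := by rw [sub_smul, one_smul]
      rw [this, map_smul_eq_mul, Real.norm_of_nonneg (by linarith), sub_mul, one_mul,
        div_mul_cancel₀ _ hq0.ne']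
    have h4 : q (G y) ≤ q (G y - G (t • y)) + q (G (t • y)) := by
      simpa using map_add_le_add q (G y - G (t • y)) (G (t • y))
    rw [hqt] at h1
    rw [h3] at h2
    linarith
  have hGit : ∀ m, G^[m] = S^[n * m] := fun m => (Function.iterate_mul S n m).symm
  obtain ⟨m, hm⟩ : ∃ m, q (G^[m] x) ≤ δ := by
    by_contra! hcon
    have hdec : ∀ m : ℕ, q (G^[m] x) ≤ q x - m * ((1 - c) * δ) := by
      intro m
      induction m with
      | zero => simp
      | succ m ih =>
        rw [Function.iterate_succ_apply']
        have := hfar (G^[m] x) (by rw [hGit]; exact hiter _ _ hx) (hcon m)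
        push_cast
        linarith
    have hpos : 0 < (1 - c) * δ := mul_pos (by linarith) hδ
    obtain ⟨m, hm⟩ := exists_nat_gt (q x / ((1 - c) * δ))
    rw [div_lt_iff₀ hpos] at hm
    linarith [hdec m, hcon m]
  have hgeo : ∀ j, q (G^[m + j] x) ≤ δ * c ^ j := by
    intro j
    induction j with
    | zero => simpa using hm
    | succ j ih =>
      rw [← add_assoc, Function.iterate_succ_apply']
      have h1 : δ * c ^ j ≤ δ := mul_le_of_le_one_right hδ.le (pow_le_one₀ hc0.le hc1.le)
      calc q (G (G^[m + j] x)) ≤ c * q (G^[m + j] x) :=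
            hloc _ (by rw [hGit]; exact hiter _ _ hx) (ih.trans h1)
        _ ≤ c * (δ * c ^ j) := by gcongr
        _ = δ * c ^ (j + 1) := by ring
  -- The extra `n` in the exponent covers the remainder `k % n`.
  refine ⟨δ / r ^ (n * m + n), ?_⟩
  filter_upwards [eventually_ge_atTop (n * m)] with k hk
  have hn0 : 0 < n := Nat.pos_of_ne_zero hn
  obtain ⟨j, hj⟩ : ∃ j, k / n = m + j :=
    Nat.exists_eq_add_of_le ((Nat.le_div_iff_mul_le hn0).2 (by rwa [mul_comm]))
  have hk' : k = k % n + n * (m + j) := by rw [← hj]; exact (Nat.mod_add_div k n).symm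
  have hmod := Nat.mod_lt k hn0
  calc ‖S^[k] x‖ ≤ q (S^[k] x) := hW _ (hiter _ _ hx)
    _ = q (S^[k % n] (S^[n * (m + j)] x)) := by rw [← Function.iterate_add_apply, ← hk']
    _ ≤ q (S^[n * (m + j)] x) := hnon0 _ _
    _ = q (G^[m + j] x) := by rw [hGit]
    _ ≤ δ * c ^ j := hgeo j
    _ = δ * r ^ (n * j) := by rw [hc, pow_mul]
    _ = δ / r ^ (n * m + n) * r ^ (n * j + (n * m + n)) := by
        rw [pow_add r (n * j)]; field_simp
    _ ≤ δ / r ^ (n * m + n) * r ^ k := by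
        refine mul_le_mul_of_nonneg_left (pow_le_pow_of_le_one hr0.le hr1.le ?_) (by positivity)
        rw [mul_add] at hk'
        omega

/-! ### Spectrum of the linearization -/

open scoped Matrix Matrix.Norms.Operator ENNReal

/-- If `A u = lam u` and `A y = μ y + s u`, with `u` and `y` linearly independent, then `μ` is an
eigenvalue of `A` besides one occurrence of `lam`. -/
theorem mem_erase_roots_charpoly {n : Type*} [Fintype n] [DecidableEq n] {A : Matrix n n ℂ}
    {u y : n → ℂ} {lam μ s : ℂ} (huy : LinearIndependent ℂ ![u, y]) (hu : A *ᵥ u = lam • u)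
    (hy : A *ᵥ y = μ • y + s • u) : μ ∈ A.charpoly.roots.erase lam := by
  have hne : A.charpoly ≠ 0 := A.charpoly_monic.ne_zero
  have huy' := LinearIndependent.pair_iff.1 huy
  by_cases hμ : μ = lam
  · subst hμ
    have hmemu : u ∈ Module.End.maxGenEigenspace (Matrix.toLin' A) μ := by
      rw [Module.End.mem_maxGenEigenspace]
      exact ⟨1, by simp [hu]⟩
    have hmemy : y ∈ Module.End.maxGenEigenspace (Matrix.toLin' A) μ := by
      rw [Module.End.mem_maxGenEigenspace]
      refine ⟨2, ?_⟩
      have h1 : (Matrix.toLin' A - μ • (1 : Module.End ℂ (n → ℂ))) y = s • u := by simp [hy]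
      have h2 : (Matrix.toLin' A - μ • (1 : Module.End ℂ (n → ℂ))) u = 0 := by simp [hu]
      rw [pow_two, Module.End.mul_apply, h1, map_smul, h2, smul_zero]
    -- One copy of `lam` is erased, so multiplicity two is required; `u` and `y` span a plane in the
    -- generalized eigenspace.
    have h2 : 2 ≤ A.charpoly.rootMultiplicity μ := by
      rw [← Matrix.charpoly_toLin', ← LinearMap.finrank_maxGenEigenspace_eq]
      have hli : LinearIndependent ℂ
          (![⟨u, hmemu⟩, ⟨y, hmemy⟩] : Fin 2 → Module.End.maxGenEigenspace (Matrix.toLin' A) μ) := by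
        rw [LinearIndependent.pair_iff]
        intro a b hab
        exact huy' a b (by simpa using congrArg Subtype.val hab)
      simpa using hli.fintype_card_le_finrank
    rw [← Multiset.count_pos, Multiset.count_erase_self, Polynomial.count_roots]
    omega
  · rw [Multiset.mem_erase_of_ne hμ, Polynomial.mem_roots hne, ← Matrix.charpoly_toLin', ← Module.End.hasEigenvalue_iff_isRoot_charpoly]
    have hd : μ - lam ≠ 0 := sub_ne_zero.2 hμ
    -- The coefficient `t` of `u` solves `s + t * lam = μ * t`.
    refine Module.End.hasEigenvalue_of_hasEigenvector (x := y + (s / (μ - lam)) • u) ⟨?_, ?_⟩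
    · rw [Module.End.mem_eigenspace_iff, Matrix.toLin'_apply, Matrix.mulVec_add,
        Matrix.mulVec_smul, hu, hy]
      ext i
      simp only [Pi.add_apply, Pi.smul_apply, smul_eq_mul]
      field_simp
      ring
    · intro h0
      have := huy' (s / (μ - lam)) 1 (by rw [one_smul, add_comm]; exact h0)
      exact one_ne_zero this.2

/-- The projection onto vectors of zero mean, along constant vectors. -/
def centering (K : Type*) [Field K] (N : ℕ) : Matrix (Fin N) (Fin N) K :=
  1 - (N : K)⁻¹ • Matrix.of fun _ _ => 1

theorem centering_mulVec {K : Type*} [Field K] {N : ℕ} (x : Fin N → K) (i : Fin N) :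
    (centering K N *ᵥ x) i = x i - (∑ j, x j) / N := by
  rw [centering, Matrix.sub_mulVec, Matrix.one_mulVec, Matrix.smul_mulVec]
  simp [Matrix.mulVec, dotProduct, div_eq_inv_mul]

theorem sum_centering_mulVec {K : Type*} [Field K] [CharZero K] {N : ℕ} (hN : N ≠ 0)
    (x : Fin N → K) : ∑ i, (centering K N *ᵥ x) i = 0 := by
  simp only [centering_mulVec, Finset.sum_sub_distrib, Finset.sum_const, Finset.card_univ,
    Fintype.card_fin, nsmul_eq_mul]
  rw [mul_div_cancel₀ _ (Nat.cast_ne_zero.2 hN), sub_self]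

/-- The linearization at the fixed point, in logarithmic coordinates, of the Krasnoselskii-Mann
step of a map with derivative `A` at the eigenvector `u`. -/
def kmLin {K : Type*} [Field K] {N : ℕ} (A : Matrix (Fin N) (Fin N) K) (u : Fin N → K) (lam : K) :
    Matrix (Fin N) (Fin N) K :=
  centering K N *
    ((2 : K)⁻¹ • (1 + Matrix.diagonal (fun i => (lam * u i)⁻¹) * A * Matrix.diagonal u))

theorem kmLin_mulVec {K : Type*} [Field K] {N : ℕ} (A : Matrix (Fin N) (Fin N) K) (u : Fin N → K)
    (lam : K) (x : Fin N → K) :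
    kmLin A u lam *ᵥ x =
      centering K N *ᵥ (fun i => 2⁻¹ * (x i + (lam * u i)⁻¹ * (A *ᵥ (u * x)) i)) := by
  have h : Matrix.diagonal u *ᵥ x = u * x := by ext i; simp [Matrix.mulVec_diagonal]
  rw [kmLin, ← Matrix.mulVec_mulVec, Matrix.smul_mulVec, Matrix.add_mulVec, Matrix.one_mulVec,
    ← Matrix.mulVec_mulVec, h, ← Matrix.mulVec_mulVec]
  congr 1
  ext i
  rw [Pi.smul_apply, Pi.add_apply, Matrix.mulVec_diagonal, smul_eq_mul]

theorem map_kmLin {N : ℕ} (A : Matrix (Fin N) (Fin N) ℝ) (u : Fin N → ℝ) (lam : ℝ) :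
    (kmLin A u lam).map ((↑) : ℝ → ℂ) =
      kmLin (A.map ((↑) : ℝ → ℂ)) (fun i => (u i : ℂ)) (lam : ℂ) := by
  ext i j
  simp [kmLin, centering, Matrix.mul_apply, Matrix.diagonal_apply, Matrix.one_apply, apply_ite]

/-- An eigenvector `z` for `ν ≠ 0` lies in the range of the centering, so it has zero sum. Hence `u
* z` is independent of `u`, and `A` maps it to `lam * (2 * ν - 1)` times itself plus a multiple of
`u`; `mem_erase_roots_charpoly` applies. -/
theorem nnnorm_le_rate {N : ℕ} (hN : N ≠ 0) {A : Matrix (Fin N) (Fin N) ℝ} {u : Fin N → ℝ}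
    {lam : ℝ} (hu : ∀ i, u i ≠ 0) (hlam : lam ≠ 0) (hA : A *ᵥ u = lam • u) {ν : ℂ}
    (hν : ν ∈ spectrum ℂ ((kmLin A u lam).map ((↑) : ℝ → ℂ))) : ‖ν‖₊ ≤ rate A lam := by
  by_cases hν0 : ν = 0
  · simp [hν0]
  rw [map_kmLin, ← Matrix.spectrum_toLin', ← Module.End.hasEigenvalue_iff_mem_spectrum] at hν
  obtain ⟨z, hz, hz0⟩ := hν.exists_hasEigenvector
  set uc : Fin N → ℂ := fun i => (u i : ℂ) with huc
  set Ac := A.map ((↑) : ℝ → ℂ) with hAc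
  have hlamc : (lam : ℂ) ≠ 0 := by exact_mod_cast hlam
  have hucne : ∀ i, uc i ≠ 0 := fun i => by simpa [huc] using hu i
  rw [Module.End.mem_eigenspace_iff, Matrix.toLin'_apply, kmLin_mulVec] at hz
  set w : Fin N → ℂ := fun i => 2⁻¹ * (z i + ((lam : ℂ) * uc i)⁻¹ * (Ac *ᵥ (uc * z)) i) with hw
  have hsum : ∑ i, z i = 0 := by
    have h1 := sum_centering_mulVec hN w
    rw [hz] at h1
    simpa [← Finset.mul_sum, hν0] using h1
  have hAu : Ac *ᵥ uc = (lam : ℂ) • uc := by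
    ext i
    have h1 := congrFun hA i
    simp only [Matrix.mulVec, dotProduct, Pi.smul_apply, smul_eq_mul] at h1 ⊢
    simp only [hAc, huc, Matrix.map_apply]
    exact_mod_cast h1
  have hAy : Ac *ᵥ (uc * z) =
      ((lam : ℂ) * (2 * ν - 1)) • (uc * z) + ((lam : ℂ) * (2 * ((∑ j, w j) / N))) • uc := by
    ext i
    have h1 := congrFun hz i
    rw [centering_mulVec] at h1
    have h2 : w i = 2⁻¹ * (z i + ((lam : ℂ) * uc i)⁻¹ * (Ac *ᵥ (uc * z)) i) := rfl
    rw [Pi.smul_apply, smul_eq_mul, sub_eq_iff_eq_add, h2] at h1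
    have hui := hucne i
    field_simp at h1
    simp only [Pi.add_apply, Pi.smul_apply, Pi.mul_apply, smul_eq_mul]
    have hNc : (N : ℂ) ≠ 0 := Nat.cast_ne_zero.2 hN
    field_simp
    linear_combination h1
  have hli : LinearIndependent ℂ ![uc, uc * z] := by
    rw [LinearIndependent.pair_iff]
    intro a b hab
    have h1 : ∀ i, a + b * z i = 0 := by
      intro i
      have h2 := congrFun hab i
      simp only [Pi.add_apply, Pi.smul_apply, Pi.mul_apply, smul_eq_mul, Pi.zero_apply] at h2
      exact mul_left_cancel₀ (hucne i) (by linear_combination h2)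
    have ha : a = 0 := by
      have h2 : ∑ i, (a + b * z i) = 0 := Finset.sum_eq_zero fun i _ => h1 i
      simpa [Finset.sum_add_distrib, ← Finset.mul_sum, hsum, hN] using h2
    refine ⟨ha, ?_⟩
    by_contra hb
    refine hz0 (funext fun i => ?_)
    have h2 := h1 i
    simpa [ha, hb] using h2
  have hmem := mem_erase_roots_charpoly hli hAu hAy
  have hle := Multiset.le_sup (Multiset.mem_map_of_mem
    (fun μ : ℂ => ‖1 + μ * (lam : ℂ)⁻¹‖₊ / 2) hmem)
  refine le_trans (le_of_eq ?_) hle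
  have h3 : 1 + (lam : ℂ) * (2 * ν - 1) * (lam : ℂ)⁻¹ = 2 * ν := by field_simp; ring
  simp [h3]

/-! ### Decay of matrix powers -/

/-- Gelfand's formula for real matrices. -/
theorem eventually_norm_pow_le {N : ℕ} (B : Matrix (Fin N) (Fin N) ℝ) {θ : ℝ≥0}
    (hB : ∀ ν ∈ spectrum ℂ (B.map ((↑) : ℝ → ℂ)), ‖ν‖₊ ≤ θ) {r : ℝ} (hr : θ < r) :
    ∀ᶠ n : ℕ in atTop, ‖B ^ n‖ ≤ r ^ n := by
  have hr0 : 0 < r := θ.2.trans_lt hr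
  have hsr : spectralRadius ℂ (B.map ((↑) : ℝ → ℂ)) < ENNReal.ofReal r := by
    refine lt_of_le_of_lt (b := (θ : ℝ≥0∞)) (iSup₂_le fun ν hν => by exact_mod_cast hB ν hν) ?_
    rw [← ENNReal.ofReal_coe_nnreal]
    exact (ENNReal.ofReal_lt_ofReal_iff hr0).2 hr
  have hlim := spectrum.pow_norm_pow_one_div_tendsto_nhds_spectralRadius (B.map ((↑) : ℝ → ℂ))
  have hnorm : ∀ n, ‖(B.map ((↑) : ℝ → ℂ)) ^ n‖ = ‖B ^ n‖ := by
    intro n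
    have h1 : (B.map ((↑) : ℝ → ℂ)) ^ n = (B ^ n).map ((↑) : ℝ → ℂ) :=
      (map_pow (Complex.ofRealHom.mapMatrix) B n).symm
    rw [h1, Matrix.linfty_opNorm_def, Matrix.linfty_opNorm_def]
    simp [Complex.nnnorm_real]
  filter_upwards [hlim.eventually_lt_const hsr, eventually_gt_atTop 0] with n hn hn0
  rw [ENNReal.ofReal_lt_ofReal_iff hr0, hnorm] at hn
  have h2 := pow_le_pow_left₀ (by positivity) hn.le n
  rwa [one_div, Real.rpow_inv_natCast_pow (norm_nonneg _) hn0.ne'] at h2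

/-- An intermediate rate `r' < r` leaves a factor `(r' / r) ^ n` that absorbs `C`. -/
theorem exists_mul_norm_pow_lt {N : ℕ} (B : Matrix (Fin N) (Fin N) ℝ) {θ : ℝ≥0}
    (hB : ∀ ν ∈ spectrum ℂ (B.map ((↑) : ℝ → ℂ)), ‖ν‖₊ ≤ θ) {r : ℝ} (hr : θ < r) (C : ℝ) :
    ∃ n ≠ 0, C * ‖(LinearMap.toContinuousLinearMap (Matrix.toLin' B)) ^ n‖ < r ^ n := by
  obtain ⟨r', hr', hrr⟩ := exists_between hr
  have hr'0 : 0 < r' := θ.2.trans_lt hr'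
  have hr0 : 0 < r := hr'0.trans hrr
  have hlim : Tendsto (fun n : ℕ => (|C| + 1) * (r' / r) ^ n) atTop (𝓝 0) := by
    simpa using (tendsto_pow_atTop_nhds_zero_of_lt_one (by positivity)
      ((div_lt_one hr0).2 hrr)).const_mul (|C| + 1)
  obtain ⟨n, hn, hn1, hn0⟩ := ((eventually_norm_pow_le B hB hr').and
    ((hlim.eventually_lt_const one_pos).and (eventually_ne_atTop 0))).exists
  refine ⟨n, hn0, ?_⟩
  have h1 : (LinearMap.toContinuousLinearMap (Matrix.toLin' B)) ^ n =
      LinearMap.toContinuousLinearMap (Matrix.toLin' (B ^ n)) := by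
    ext1 x
    rw [Matrix.toLin'_pow]
    simp [Module.End.pow_apply]
  have h2 : ‖LinearMap.toContinuousLinearMap (Matrix.toLin' (B ^ n))‖ = ‖B ^ n‖ :=
    (Matrix.linfty_opNorm_eq_opNorm (B ^ n)).symm
  rw [h1, h2]
  rw [div_pow, ← mul_div_assoc, div_lt_one (by positivity)] at hn1
  calc C * ‖B ^ n‖ ≤ (|C| + 1) * ‖B ^ n‖ := by
        gcongr; linarith [le_abs_self C]
    _ ≤ (|C| + 1) * r' ^ n := by gcongr
    _ < r ^ n := hn1

/-! ### Oscillation and zero-sum vectors -/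

/-- The oscillation seminorm `max x - min x`. -/
noncomputable def oscSeminorm (N : ℕ) : Seminorm ℝ (Fin N → ℝ) :=
  (normSeminorm ℝ (Fin N × Fin N → ℝ)).comp
    (LinearMap.pi fun p => LinearMap.proj (R := ℝ) (φ := fun _ : Fin N => ℝ) p.1 -
      LinearMap.proj p.2)

theorem oscSeminorm_le {N : ℕ} {x : Fin N → ℝ} {a : ℝ} (ha : 0 ≤ a) (h : ∀ i j, x i - x j ≤ a) :
    oscSeminorm N x ≤ a := by
  refine (pi_norm_le_iff_of_nonneg ha).2 fun p => ?_
  exact abs_le.2 ⟨by have := h p.2 p.1; simp; linarith, h p.1 p.2⟩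

theorem sub_le_oscSeminorm {N : ℕ} (x : Fin N → ℝ) (i j : Fin N) :
    x i - x j ≤ oscSeminorm N x :=
  (le_abs_self _).trans (norm_le_pi_norm (fun p : Fin N × Fin N => x p.1 - x p.2) (i, j))

theorem oscSeminorm_le_two_mul_norm {N : ℕ} (x : Fin N → ℝ) : oscSeminorm N x ≤ 2 * ‖x‖ := by
  refine oscSeminorm_le (by positivity) fun i j => ?_
  have h1 := (abs_le.1 (norm_le_pi_norm x i)).2
  have h2 := (abs_le.1 (norm_le_pi_norm x j)).1
  linarith

/-- The vectors of zero sum. -/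
def zeroSum (N : ℕ) : Submodule ℝ (Fin N → ℝ) :=
  LinearMap.ker (∑ i, LinearMap.proj i : (Fin N → ℝ) →ₗ[ℝ] ℝ)

theorem mem_zeroSum {N : ℕ} {x : Fin N → ℝ} : x ∈ zeroSum N ↔ ∑ i, x i = 0 := by
  simp [zeroSum]

/-- A zero-sum vector has an entry `≤ 0` and an entry `≥ 0` to compare with. -/
theorem norm_le_oscSeminorm {N : ℕ} {x : Fin N → ℝ} (hx : x ∈ zeroSum N) :
    ‖x‖ ≤ oscSeminorm N x := by
  rw [mem_zeroSum] at hx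
  refine (pi_norm_le_iff_of_nonneg (apply_nonneg _ _)).2 fun i => ?_
  have hne : (Finset.univ : Finset (Fin N)).Nonempty := ⟨i, Finset.mem_univ i⟩
  obtain ⟨j, -, hj⟩ := Finset.exists_le_of_sum_le (f := x) (g := fun _ => 0) hne (by simp [hx])
  obtain ⟨k, -, hk⟩ := Finset.exists_le_of_sum_le (f := fun _ => 0) (g := x) hne (by simp [hx])
  have h1 := sub_le_oscSeminorm x i j
  have h2 := sub_le_oscSeminorm x k i
  exact abs_le.2 ⟨by linarith, by linarith⟩

/-! ### The iteration in logarithmic coordinates -/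

/-- The map `f`, scaled by `lam⁻¹`, in logarithmic coordinates centered at `u`. -/
noncomputable def logConj {N : ℕ} (f : (Fin N → ℝ) → (Fin N → ℝ)) (u : Fin N → ℝ) (lam : ℝ) (x : Fin N → ℝ) :
    Fin N → ℝ :=
  fun i => Real.log (f (fun j => u j * Real.exp (x j)) i / (lam * u i))

/-- The Krasnoselskii-Mann step in logarithmic coordinates centered at `u`. -/
noncomputable def kmLog {N : ℕ} (f : (Fin N → ℝ) → (Fin N → ℝ)) (u : Fin N → ℝ) (lam : ℝ) (x : Fin N → ℝ) :
    Fin N → ℝ :=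
  centering ℝ N *ᵥ fun i => 2⁻¹ * (x i + logConj f u lam x i)

section

variable {N : ℕ} {f : (Fin N → ℝ) → (Fin N → ℝ)} {u : Fin N → ℝ} {lam : ℝ}

theorem pos_of_monotone_of_homogeneous (hmono : MonotoneOn f {x | 0 ≤ x})
    (hhom : ∀ c : ℝ, 0 < c → ∀ x : Fin N → ℝ, 0 ≤ x → f (c • x) = c • f x)
    (hu : ∀ i, 0 < u i) (hlam : 0 < lam) (heig : f u = lam • u) {v : Fin N → ℝ}
    (hv : ∀ i, 0 < v i) (i : Fin N) : 0 < f v i := by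
  have : Nonempty (Fin N) := ⟨i⟩
  -- The least ratio gives a positive multiple of `u` below `v`.
  obtain ⟨j, hj⟩ := Finite.exists_min fun i => v i / u i
  have hc : 0 < v j / u j := div_pos (hv j) (hu j)
  have hu0 : 0 ≤ u := fun i => (hu i).le
  have hle : (v j / u j) • u ≤ v := fun i => (le_div_iff₀ (hu i)).1 (hj i)
  have h1 := hmono (smul_nonneg hc.le hu0) (fun i => (hv i).le : 0 ≤ v) hle i
  rw [hhom _ hc u hu0, heig] at h1
  have := hu i
  exact lt_of_lt_of_le (by simp only [Pi.smul_apply, smul_eq_mul]; positivity) h1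

theorem logConj_le_add (hmono : MonotoneOn f {x | 0 ≤ x})
    (hhom : ∀ c : ℝ, 0 < c → ∀ x : Fin N → ℝ, 0 ≤ x → f (c • x) = c • f x)
    (hu : ∀ i, 0 < u i) (hlam : 0 < lam) (heig : f u = lam • u) {x y : Fin N → ℝ} {a : ℝ}
    (hxy : ∀ i, x i - y i ≤ a) (i : Fin N) : logConj f u lam x i ≤ logConj f u lam y i + a := by
  have hpos : ∀ z : Fin N → ℝ, ∀ i, 0 < u i * Real.exp (z i) :=
    fun z i => mul_pos (hu i) (Real.exp_pos _)
  have hnn : ∀ z : Fin N → ℝ, 0 ≤ fun j => u j * Real.exp (z j) := fun z i => (hpos z i).le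
  have hle : (fun j => u j * Real.exp (x j)) ≤ Real.exp a • fun j => u j * Real.exp (y j) := by
    intro j
    simp only [Pi.smul_apply, smul_eq_mul]
    rw [mul_left_comm, ← Real.exp_add]
    exact mul_le_mul_of_nonneg_left (Real.exp_le_exp.2 (by linarith [hxy j])) (hu j).le
  have h1 := hmono (hnn x) (smul_nonneg (Real.exp_pos a).le (hnn y)) hle i
  rw [hhom _ (Real.exp_pos a) _ (hnn y), Pi.smul_apply, smul_eq_mul] at h1
  have hfx := pos_of_monotone_of_homogeneous hmono hhom hu hlam heig (hpos x) i
  have hfy := pos_of_monotone_of_homogeneous hmono hhom hu hlam heig (hpos y) i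
  have hlu : 0 < lam * u i := mul_pos hlam (hu i)
  have h2 : logConj f u lam y i + a =
      Real.log (Real.exp a * f (fun j => u j * Real.exp (y j)) i / (lam * u i)) := by
    rw [mul_div_assoc, Real.log_mul (Real.exp_pos a).ne' (div_pos hfy hlu).ne', Real.log_exp,
      add_comm]
    rfl
  rw [h2]
  exact Real.log_le_log (div_pos hfx hlu) (by gcongr)

/-- The mean removed by centering is the same in all coordinates, so it cancels in differences of
coordinates. -/
theorem oscSeminorm_kmLog_sub_le (hmono : MonotoneOn f {x | 0 ≤ x})
    (hhom : ∀ c : ℝ, 0 < c → ∀ x : Fin N → ℝ, 0 ≤ x → f (c • x) = c • f x)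
    (hu : ∀ i, 0 < u i) (hlam : 0 < lam) (heig : f u = lam • u) (x y : Fin N → ℝ) :
    oscSeminorm N (kmLog f u lam x - kmLog f u lam y) ≤ oscSeminorm N (x - y) := by
  refine oscSeminorm_le (apply_nonneg _ _) fun i j => ?_
  have : Nonempty (Fin N) := ⟨i⟩
  obtain ⟨b, hb⟩ := Finite.exists_max fun i => x i - y i
  obtain ⟨c, hc⟩ := Finite.exists_max fun i => y i - x i
  have h1 := logConj_le_add hmono hhom hu hlam heig hb i
  have h2 := logConj_le_add hmono hhom hu hlam heig hc j
  have h3 := sub_le_oscSeminorm (x - y) b c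
  have h4 := sub_le_oscSeminorm (x - y) i j
  simp only [Pi.sub_apply] at h3 h4
  simp only [Pi.sub_apply, kmLog, centering_mulVec]
  linarith

theorem logConj_zero (hu : ∀ i, 0 < u i) (hlam : 0 < lam) (heig : f u = lam • u) :
    logConj f u lam 0 = 0 := by
  ext i
  simp [logConj, heig, div_self (mul_pos hlam (hu i)).ne']

theorem kmLog_zero (hu : ∀ i, 0 < u i) (hlam : 0 < lam) (heig : f u = lam • u) :
    kmLog f u lam 0 = 0 := by
  ext i
  simp [kmLog, centering_mulVec, logConj_zero hu hlam heig]

theorem jacobian_mulVec (x : Fin N → ℝ) : jacobian f u *ᵥ x = fderiv ℝ f u x := by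
  rw [jacobian, LinearMap.toMatrix'_mulVec]
  rfl

/-- Euler's identity at an eigenvector. -/
theorem jacobian_mulVec_self
    (hhom : ∀ c : ℝ, 0 < c → ∀ x : Fin N → ℝ, 0 ≤ x → f (c • x) = c • f x)
    (hu : ∀ i, 0 < u i) (heig : f u = lam • u) (hdiff : DifferentiableAt ℝ f u) :
    jacobian f u *ᵥ u = lam • u := by
  rw [jacobian_mulVec]
  have h1 : HasDerivAt (fun t : ℝ => t • u) u 1 := by
    simpa using (hasDerivAt_id (1 : ℝ)).smul_const u
  have h2 : HasDerivAt (fun t : ℝ => f (t • u)) (fderiv ℝ f u u) 1 :=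
    HasFDerivAt.comp_hasDerivAt (l := f) (1 : ℝ) (by simpa using hdiff.hasFDerivAt) h1
  have h3 : HasDerivAt (fun t : ℝ => t • f u) (f u) 1 := by
    simpa using (hasDerivAt_id (1 : ℝ)).smul_const (f u)
  have h4 : (fun t : ℝ => f (t • u)) =ᶠ[𝓝 1] fun t => t • f u := by
    filter_upwards [eventually_gt_nhds (zero_lt_one' ℝ)] with t ht
    exact hhom t ht u fun i => (hu i).le
  rw [← heig]
  exact h2.unique (h3.congr_of_eventuallyEq h4)

theorem hasFDerivAt_kmLog (hu : ∀ i, 0 < u i) (hlam : 0 < lam) (heig : f u = lam • u)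
    (hdiff : DifferentiableAt ℝ f u) :
    HasFDerivAt (kmLog f u lam)
      (LinearMap.toContinuousLinearMap (Matrix.toLin' (kmLin (jacobian f u) u lam))) 0 := by
  have hexp : HasFDerivAt (fun (x : Fin N → ℝ) (j : Fin N) => u j * Real.exp (x j))
      (ContinuousLinearMap.pi fun j =>
        u j • (ContinuousLinearMap.proj j : (Fin N → ℝ) →L[ℝ] ℝ)) 0 := by
    refine hasFDerivAt_pi.2 fun j => ?_
    have h1 := ((hasFDerivAt_apply (𝕜 := ℝ) j (0 : Fin N → ℝ)).exp).const_mul (u j)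
    simpa using h1
  have hf : HasFDerivAt (fun x : Fin N → ℝ => f fun j => u j * Real.exp (x j))
      ((fderiv ℝ f u).comp (ContinuousLinearMap.pi fun j => u j • ContinuousLinearMap.proj j)) 0 :=
    HasFDerivAt.comp (g := f) (0 : Fin N → ℝ) (by simpa using hdiff.hasFDerivAt) hexp
  have hT : ∀ i, HasFDerivAt (fun x => logConj f u lam x i)
      ((lam * u i)⁻¹ • (ContinuousLinearMap.proj i).comp ((fderiv ℝ f u).comp
        (ContinuousLinearMap.pi fun j => u j • ContinuousLinearMap.proj j))) 0 := by
    intro i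
    have hlu : lam * u i ≠ 0 := (mul_pos hlam (hu i)).ne'
    have h1 := (hasFDerivAt_pi'.1 hf i).mul_const (lam * u i)⁻¹
    have hval : f (fun j => u j * Real.exp ((0 : Fin N → ℝ) j)) i * (lam * u i)⁻¹ = 1 := by
      simp only [Pi.zero_apply, Real.exp_zero, mul_one, heig]
      exact mul_inv_cancel₀ hlu
    have h2 := h1.log (by rw [hval]; exact one_ne_zero)
    rw [hval, inv_one, one_smul] at h2
    exact h2
  have hsum : HasFDerivAt (fun (x : Fin N → ℝ) (i : Fin N) => 2⁻¹ * (x i + logConj f u lam x i))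
      (ContinuousLinearMap.pi fun i => (2⁻¹ : ℝ) • (ContinuousLinearMap.proj i +
        (lam * u i)⁻¹ • (ContinuousLinearMap.proj i).comp ((fderiv ℝ f u).comp
          (ContinuousLinearMap.pi fun j => u j • ContinuousLinearMap.proj j)))) 0 :=
    hasFDerivAt_pi.2 fun i =>
      ((hasFDerivAt_apply (𝕜 := ℝ) i (0 : Fin N → ℝ)).add (hT i)).const_mul _
  have hS := (LinearMap.toContinuousLinearMap (Matrix.toLin' (centering ℝ N))).hasFDerivAt.comp
    (0 : Fin N → ℝ) hsum
  refine hS.congr_fderiv ?_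
  ext1 x
  simp only [ContinuousLinearMap.comp_apply, LinearMap.coe_toContinuousLinearMap',
    Matrix.toLin'_apply, kmLin_mulVec, jacobian_mulVec]
  rfl

theorem kmStep_pos (hmono : MonotoneOn f {x | 0 ≤ x})
    (hhom : ∀ c : ℝ, 0 < c → ∀ x : Fin N → ℝ, 0 ≤ x → f (c • x) = c • f x)
    (hu : ∀ i, 0 < u i) (hlam : 0 < lam) (heig : f u = lam • u) {v : Fin N → ℝ}
    (hv : ∀ i, 0 < v i) (i : Fin N) : 0 < kmStep f v i := by
  have hf := pos_of_monotone_of_homogeneous hmono hhom hu hlam heig hv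
  have hG : 0 < geomMean (f v) := Real.rpow_pos_of_pos (Finset.prod_pos fun i _ => hf i) _
  exact Real.sqrt_pos.2 (mul_pos (div_pos (hf i) hG) (hv i))

theorem log_geomMean {x : Fin N → ℝ} (hx : ∀ i, 0 < x i) :
    Real.log (geomMean x) = (∑ i, Real.log (x i)) / N := by
  rw [geomMean, Real.log_rpow (Finset.prod_pos fun i _ => hx i),
    Real.log_prod fun i _ => (hx i).ne']
  ring

/-- Dividing by the geometric mean is centering of logarithms; it also cancels `log lam`. -/
theorem log_kmStep_sub_log (hmono : MonotoneOn f {x | 0 ≤ x})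
    (hhom : ∀ c : ℝ, 0 < c → ∀ x : Fin N → ℝ, 0 ≤ x → f (c • x) = c • f x)
    (hu : ∀ i, 0 < u i) (hlam : 0 < lam) (heig : f u = lam • u) (hN : N ≠ 0)
    (hunorm : ∑ i, Real.log (u i) = 0) {v : Fin N → ℝ} (hv : ∀ i, 0 < v i)
    (hvnorm : ∑ i, Real.log (v i) = 0) :
    (fun i => Real.log (kmStep f v i) - Real.log (u i)) =
      kmLog f u lam fun i => Real.log (v i) - Real.log (u i) := by
  have hf := pos_of_monotone_of_homogeneous hmono hhom hu hlam heig hv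
  have hG : 0 < geomMean (f v) := Real.rpow_pos_of_pos (Finset.prod_pos fun i _ => hf i) _
  have hvx : (fun j => u j * Real.exp (Real.log (v j) - Real.log (u j))) = v := by
    ext j
    rw [Real.exp_sub, Real.exp_log (hv j), Real.exp_log (hu j), mul_div_cancel₀ _ (hu j).ne']
  have hT : ∀ i, logConj f u lam (fun i => Real.log (v i) - Real.log (u i)) i =
      Real.log (f v i) - (Real.log lam + Real.log (u i)) := by
    intro i
    simp only [logConj]
    rw [hvx, Real.log_div (hf i).ne' (mul_pos hlam (hu i)).ne', Real.log_mul hlam.ne' (hu i).ne']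
  ext i
  have hsqrt : Real.log (kmStep f v i) =
      (Real.log (f v i) - (∑ j, Real.log (f v j)) / N + Real.log (v i)) / 2 := by
    rw [kmStep, Real.log_sqrt (mul_pos (div_pos (hf i) hG) (hv i)).le,
      Real.log_mul (div_pos (hf i) hG).ne' (hv i).ne', Real.log_div (hf i).ne' hG.ne',
      log_geomMean hf]
  have hNr : (N : ℝ) ≠ 0 := Nat.cast_ne_zero.2 hN
  rw [kmLog, centering_mulVec, hsqrt]
  simp only [hT, ← Finset.mul_sum, Finset.sum_add_distrib, Finset.sum_sub_distrib, hunorm, hvnorm,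
    Finset.sum_const, Finset.card_univ, Fintype.card_fin, nsmul_eq_mul]
  field_simp
  ring

theorem log_kmSeq_sub_log (hmono : MonotoneOn f {x | 0 ≤ x})
    (hhom : ∀ c : ℝ, 0 < c → ∀ x : Fin N → ℝ, 0 ≤ x → f (c • x) = c • f x)
    (hu : ∀ i, 0 < u i) (hlam : 0 < lam) (heig : f u = lam • u) (hN : N ≠ 0)
    (hunorm : ∑ i, Real.log (u i) = 0) {v : Fin N → ℝ} (hv : ∀ i, 0 < v i)
    (hvnorm : ∑ i, Real.log (v i) = 0) (k : ℕ) :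
    (fun i => Real.log (kmSeq f v k i) - Real.log (u i)) =
      (kmLog f u lam)^[k] fun i => Real.log (v i) - Real.log (u i) := by
  -- Positivity and normalization of the iterate are what the next step requires.
  suffices h : (∀ i, 0 < kmSeq f v k i) ∧ ∑ i, Real.log (kmSeq f v k i) = 0 ∧
      (fun i => Real.log (kmSeq f v k i) - Real.log (u i)) =
        (kmLog f u lam)^[k] fun i => Real.log (v i) - Real.log (u i) from h.2.2
  induction k with
  | zero => exact ⟨hv, hvnorm, rfl⟩
  | succ k ih =>
    obtain ⟨hpos, hnorm, heq⟩ := ih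
    have hstep := log_kmStep_sub_log hmono hhom hu hlam heig hN hunorm hpos hnorm
    refine ⟨kmStep_pos hmono hhom hu hlam heig hpos, ?_, ?_⟩
    · have h1 : ∑ i, (Real.log (kmStep f (kmSeq f v k) i) - Real.log (u i)) = 0 := by
        rw [show ∑ i, (Real.log (kmStep f (kmSeq f v k) i) - Real.log (u i)) =
          ∑ i, kmLog f u lam (fun i => Real.log (kmSeq f v k i) - Real.log (u i)) i from
          Finset.sum_congr rfl fun i _ => congrFun hstep i]
        exact sum_centering_mulVec hN _
      rwa [Finset.sum_sub_distrib, hunorm, sub_zero] at h1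
    · rw [Function.iterate_succ_apply', ← heq]
      exact hstep

end

end ProjKM

theorem mainTheorem8 (N : ℕ) (f : (Fin N → ℝ) → (Fin N → ℝ))
    (hmaps : Set.MapsTo f {x | 0 ≤ x} {x | 0 ≤ x})
    (hmono : MonotoneOn f {x | 0 ≤ x})
    (hhom : ∀ c : ℝ, 0 < c → ∀ x : Fin N → ℝ, 0 ≤ x → f (c • x) = c • f x)
    (u : Fin N → ℝ) (lam : ℝ)
    (hu : ∀ i, 0 < u i) (hlam : 0 < lam) (heig : f u = lam • u)
    (hunorm : ∏ i, u i = 1)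
    (hdiff : DifferentiableAt ℝ f u)
    (hrate : ProjKM.rate (ProjKM.jacobian f u) lam < 1)
    (v₀ : Fin N → ℝ) (hv₀ : ∀ i, 0 < v₀ i) (hv₀norm : ∏ i, v₀ i = 1) :
    limsup (fun k : ℕ =>
        ((ProjKM.thompsonDist (ProjKM.kmSeq f v₀ k) u ^ ((1 : ℝ) / (k : ℝ)) : ℝ) : EReal)) atTop
      ≤ (((ProjKM.rate (ProjKM.jacobian f u) lam : ℝ≥0) : ℝ) : EReal) := by
  refine ProjKM.limsup_rpow_one_div_le (fun k => norm_nonneg _) (NNReal.coe_nonneg _)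
    (by exact_mod_cast hrate) fun r hr hr1 => ?_
  rcases Nat.eq_zero_or_pos N with rfl | hN
  · exact ⟨0, Eventually.of_forall fun k => by
      change ProjKM.thompsonDist (ProjKM.kmSeq f v₀ k) u ≤ _
      rw [ProjKM.thompsonDist, Subsingleton.elim (fun i => _ - _) (0 : Fin 0 → ℝ)]; simp⟩
  have hN0 : N ≠ 0 := hN.ne'
  have hlogsum : ∀ {w : Fin N → ℝ}, (∀ i, 0 < w i) → ∏ i, w i = 1 →
      ∑ i, Real.log (w i) = 0 := by
    intro w hw hw1
    rw [← Real.log_prod fun i _ => (hw i).ne', hw1, Real.log_one]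
  have hus := hlogsum hu hunorm
  have hvs := hlogsum hv₀ hv₀norm
  -- The final argument `2` is the constant of `oscSeminorm_le_two_mul_norm`.
  obtain ⟨n, hn, hBn⟩ := ProjKM.exists_mul_norm_pow_lt
    (ProjKM.kmLin (ProjKM.jacobian f u) u lam)
    (fun ν hν => ProjKM.nnnorm_le_rate hN0 (fun i => (hu i).ne') hlam.ne'
      (ProjKM.jacobian_mulVec_self hhom hu heig hdiff) hν) hr 2
  obtain ⟨K, hK⟩ := ProjKM.exists_eventually_norm_iterate_le (ProjKM.oscSeminorm N)
    (ProjKM.zeroSum N) two_pos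
    (fun x => ProjKM.mem_zeroSum.2 (ProjKM.sum_centering_mulVec hN0 _))
    (fun x hx => ProjKM.norm_le_oscSeminorm hx) ProjKM.oscSeminorm_le_two_mul_norm
    (ProjKM.oscSeminorm_kmLog_sub_le hmono hhom hu hlam heig)
    (ProjKM.kmLog_zero hu hlam heig) (ProjKM.hasFDerivAt_kmLog hu hlam heig hdiff)
    (lt_of_le_of_lt (NNReal.coe_nonneg _) hr) hr1 hn hBn
    (x := fun i => Real.log (v₀ i) - Real.log (u i))
    (ProjKM.mem_zeroSum.2 (by rw [Finset.sum_sub_distrib, hus, hvs, sub_zero]))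
  refine ⟨K, hK.mono fun k hk => ?_⟩
  change ProjKM.thompsonDist (ProjKM.kmSeq f v₀ k) u ≤ _
  rw [ProjKM.thompsonDist, ProjKM.log_kmSeq_sub_log hmono hhom hu hlam heig hN0 hus hv₀ hvs k]
  exact hk
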